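/- Let $X$ be a locale with frame of opens $\mathcal O(X)$. For $u\in\mathcal O(X)$ let ${\downarrow}u\rightarrowtail X$ be the open sublocale given by $u$, with inverse image map $x\mapsto x\wedge u$. A localic map $f:Y\to X$ is a local homeomorphism if $Y$ is covered by open sublocales $V$ for which the composite $V\rightarrowtail Y\to X$ is isomorphic to the inclusion of an open sublocale of $X$. Let $LH$ be the category of locales and local homeomorphisms, $LH/X$ its slice category over $X$, $Loc/X$ the category of all locales over $X$, and $Sh(X)\subseteq[\mathcal O(X)^{op},Set]$ the full subcategory of sheaves for the covers $u=\bigvee_i u_i$ in $\mathcal O(X)$. For a presheaf $P$ on $X$, $s\in P(u_s)$ and $t\in P(u_t)$, put $\epsilon_P(s,t)=\bigvee\{w\le u_s\wedge u_t : s|_w=t|_w\}$. Let $\Lambda(P)$ be the locale over $X$ whose frame consists of the families $(x_s)$, indexed by $s\in\coprod_{u}P(u)$, with $x_s\in\mathcal O(X)$, $x_s\le u_s$ and $x_s\wedge\epsilon_P(s,t)=x_t\wedge\epsilon_P(s,t)$ for all $s,t$, ordered pointwise, with projection $p:\Lambda(P)\to X$ given by $p^*(x)=(x\wedge u_s)_s$;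 for $\alpha:P\to Q$ let $\Lambda(\alpha)^*\big((x_t)_t\big)=(x_{\alpha(s)})_s$. This defines a functor $\Lambda:[\mathcal O(X)^{op},Set]\to Loc/X$. Let $\Gamma:Loc/X\to[\mathcal O(X)^{op},Set]$ be the functor of continuous sections: $\Gamma(f:Y\to X)(u)$ is the set of localic maps $s:{\downarrow}u\to Y$ such that $fs$ is the inclusion ${\downarrow}u\rightarrowtail X$, and restriction is composition with inclusions of open sublocales. Then $\Lambda$ is left adjoint to $\Gamma$, by an adjunction whose unit is $\eta_P:P(u)\to\Gamma\Lambda(P)(u)$, $s\mapsto p_s$, where $p_s^*\big((x_t)_t\big)=x_s$, and whose counit at $f:Y\to X$ is given by $\varepsilon_f^*:\mathcal O(Y)\to\Lambda\Gamma(f)$, $y\mapsto(s^*(y))_s$. If $f$ is a local homeomorphism, then $\varepsilon_f$ is an isomorphism; if $F$ is a sheaf on $X$, then $F(u)\to\Gamma\Lambda(F)(u)$ is a bijection for every $u\in\mathcal O(X)$. The functors $\Lambda$ and $\Gamma$ restrict (up to natural isomorphism) to mutually quasi-inverse equivalences of categories \[Sh(X)\rightleftarrows LH/X.\] Moreover,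 $Sh(X)$ is a reflective subcategory of $[\mathcal O(X)^{op},Set]$, and $LH/X$ is a coreflective (in particular full) subcategory of $Loc/X$. -/

import Mathlib

open CategoryTheory Opposite

universe u

namespace SheafLocale

/-! ### Locales, localic maps and open sublocales -/

/-- The frame homomorphism `f^* : O(X) → O(Y)` of a localic map `f : Y ⟶ X`. -/
def pull {X Y : Locale.{u}} (f : Y ⟶ X) : FrameHom X Y :=
  Frm.Hom.hom (Quiver.Hom.unop f)

/-- The localic map `Y ⟶ X` with a given frame homomorphism `O(X) → O(Y)`. -/
def ofPull {X Y : Locale.{u}} (h : FrameHom X Y) : Y ⟶ X :=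
  Quiver.Hom.op (Frm.ofHom h)

@[simp] lemma pull_ofPull {X Y : Locale.{u}} (h : FrameHom X Y) : pull (ofPull h) = h := rfl

@[simp] lemma pull_id (X : Locale.{u}) (x : X) : pull (𝟙 X) x = x := rfl

@[simp] lemma pull_comp {X Y Z : Locale.{u}} (f : Z ⟶ Y) (g : Y ⟶ X) (x : X) :
    pull (f ≫ g) x = pull f (pull g x) := rfl

lemma hom_ext {X Y : Locale.{u}} {f g : Y ⟶ X} (h : ∀ x, pull f x = pull g x) : f = g :=
  Quiver.Hom.unop_inj (Frm.hom_ext (FrameHom.ext h))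

/-- The down-set `↓a` of an element of a frame is a frame. -/
instance iicFrame {α : Type u} [Order.Frame α] (a : α) : Order.Frame (Set.Iic a) :=
  Order.Frame.ofMinimalAxioms
    { inf_sSup_le_iSup_inf := fun b s => by
        rw [← Subtype.coe_le_coe]
        change (b : α) ⊓ sSup ((↑) '' s) ≤ _
        rw [inf_sSup_eq, Set.Iic.coe_biSup]
        simp only [Set.mem_image, iSup_exists, iSup_and]
        refine iSup_le fun x => iSup_le fun y => iSup_le fun hy => iSup_le fun hyx => ?_
        subst hyx
        exact le_iSup₂_of_le y hy le_rfl }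

/-- The frame homomorphism `O(X) → ↓a`, `x ↦ x ⊓ a`. -/
def cutHom {α : Type u} [Order.Frame α] (a : α) : FrameHom α (Set.Iic a) where
  toFun x := ⟨x ⊓ a, inf_le_right⟩
  map_inf' x y := Subtype.ext (inf_inf_distrib_right x y a)
  map_top' := Subtype.ext (top_inf_eq a)
  map_sSup' s := Subtype.ext (by
    change sSup s ⊓ a = sSup ((↑) '' ((fun x => (⟨x ⊓ a, inf_le_right⟩ : Set.Iic a)) '' s))
    rw [sSup_inf_eq, Set.image_image, sSup_image])

/-- For `a ≤ b`, the frame homomorphism `↓b → ↓a`, `x ↦ x ⊓ a`. -/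
def cutHomLE {α : Type u} [Order.Frame α] {a b : α} (_h : a ≤ b) :
    FrameHom (Set.Iic b) (Set.Iic a) where
  toFun x := ⟨x.1 ⊓ a, inf_le_right⟩
  map_inf' x y := Subtype.ext (inf_inf_distrib_right x.1 y.1 a)
  map_top' := Subtype.ext (inf_eq_right.mpr _h)
  map_sSup' s := Subtype.ext (by
    change sSup ((↑) '' s) ⊓ a =
      sSup ((↑) '' ((fun x : Set.Iic b => (⟨x.1 ⊓ a, inf_le_right⟩ : Set.Iic a)) '' s))
    rw [sSup_inf_eq, Set.image_image, sSup_image, iSup_image])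

/-- The open sublocale of `X` given by `a ∈ O(X)`; its frame of opens is `↓a`. -/
def openSub (X : Locale.{u}) (a : X) : Locale.{u} := Locale.of (Set.Iic a)

/-- The inclusion of the open sublocale `a` in `X`; its inverse image map is `x ↦ x ⊓ a`. -/
def openIncl (X : Locale.{u}) (a : X) : openSub X a ⟶ X := ofPull (cutHom a)

/-- The functor `O(X) ⥤ Loc/X` that sends `a` to the open inclusion `↓a ⟶ X`, and `a ≤ b` to the
inclusion of `↓a` in `↓b`. -/
def openFunctor (X : Locale.{u}) : X ⥤ Over X where
  obj a := Over.mk (openIncl X a)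
  map {a b} h := Over.homMk (U := Over.mk (openIncl X a)) (V := Over.mk (openIncl X b))
    (ofPull (X := openSub X b) (Y := openSub X a) (cutHomLE (leOfHom h)))
    (hom_ext fun x => Subtype.ext (by
      change x ⊓ b ⊓ a = x ⊓ a
      rw [inf_assoc, inf_eq_right.mpr (leOfHom h)]))
  map_id a := by
    ext1
    exact hom_ext fun x => Subtype.ext (inf_eq_left.mpr x.2)
  map_comp {a b c} f g := by
    ext1
    refine hom_ext fun x => Subtype.ext ?_
    change x.1 ⊓ a = x.1 ⊓ b ⊓ a
    rw [inf_assoc, inf_eq_right.mpr (leOfHom f)]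

/-! ### Local homeomorphisms -/

/-- `f : Y ⟶ X` is isomorphic to the inclusion of an open sublocale of `X`. -/
def IsOpenInclusion {X Y : Locale.{u}} (f : Y ⟶ X) : Prop :=
  ∃ (a : X) (e : Y ≅ openSub X a), f = e.hom ≫ openIncl X a

/-- The class of local homeomorphisms `f : Y ⟶ X`: the locale `Y` is covered by open sublocales
`b` for which the composite `↓b ⟶ Y ⟶ X` is isomorphic to an open inclusion. -/
def localHomeo : MorphismProperty Locale.{u} := fun Y _ f =>
  ∃ S : Set Y, sSup S = ⊤ ∧ ∀ b ∈ S, IsOpenInclusion (openIncl Y b ≫ f)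

lemma isOpenInclusion_iff {X Y : Locale.{u}} (f : Y ⟶ X) (b : Y) :
    IsOpenInclusion (openIncl Y b ≫ f) ↔ ∃ a : X, b ≤ pull f a ∧
      (∀ x ≤ a, ∀ x' ≤ a, pull f x ⊓ b = pull f x' ⊓ b → x = x') ∧
      ∀ y ≤ b, ∃ x ≤ a, pull f x ⊓ b = y := by
  constructor
  · rintro ⟨a, e, h⟩
    have key : ∀ x : X, pull f x ⊓ b =
        (pull e.hom (⟨x ⊓ a, inf_le_right⟩ : Set.Iic a) : Set.Iic b).1 := fun x =>
      congrArg Subtype.val (congrArg (fun k => pull k x) h)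
    have inv1 : ∀ z : Set.Iic a, (pull e.inv (pull e.hom z : Set.Iic b) : Set.Iic a) = z :=
      fun z => congrArg (fun k => pull k z) e.inv_hom_id
    have inv2 : ∀ z : Set.Iic b, (pull e.hom (pull e.inv z : Set.Iic a) : Set.Iic b) = z :=
      fun z => congrArg (fun k => pull k z) e.hom_inv_id
    refine ⟨a, ?_, ?_, ?_⟩
    · have h1 := key a
      have h2 := key ⊤
      rw [map_top] at h2
      simp only [top_inf_eq, inf_idem] at h1 h2
      rw [← h2] at h1
      exact inf_eq_right.mp h1
    · intro x hx x' hx' hxx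
      rw [key, key] at hxx
      have h1 := (inv1 _).symm.trans ((congrArg (fun z => pull e.inv z)
        (Subtype.ext hxx)).trans (inv1 _))
      have h2 : x ⊓ a = x' ⊓ a := congrArg Subtype.val h1
      rwa [inf_eq_left.mpr hx, inf_eq_left.mpr hx'] at h2
    · intro y hy
      let z : Set.Iic a := pull e.inv (⟨y, hy⟩ : Set.Iic b)
      refine ⟨z.1, z.2, ?_⟩
      rw [key]
      have hz : (⟨z.1 ⊓ a, inf_le_right⟩ : Set.Iic a) = z := Subtype.ext (inf_eq_left.mpr z.2)
      rw [hz]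
      exact congrArg Subtype.val (inv2 ⟨y, hy⟩)
  · rintro ⟨a, hb, hinj, hsurj⟩
    have hle : ∀ x x' : Set.Iic a, pull f x.1 ⊓ b ≤ pull f x'.1 ⊓ b ↔ x ≤ x' := by
      intro x x'
      constructor
      · intro h
        have h1 : pull f (x.1 ⊓ x'.1) ⊓ b = pull f x.1 ⊓ b := by
          rw [map_inf, inf_inf_distrib_right]
          exact inf_eq_left.mpr h
        have h2 := hinj _ (inf_le_left.trans x.2) _ x.2 h1
        exact Subtype.coe_le_coe.mp (inf_eq_left.mp h2)
      · intro h
        exact inf_le_inf_right b (OrderHomClass.mono (pull f) h)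
    let e : Set.Iic a ≃o Set.Iic b :=
      { toEquiv := Equiv.ofBijective
          (fun x => (⟨pull f x.1 ⊓ b, inf_le_right⟩ : Set.Iic b))
          ⟨fun x x' h => Subtype.ext (hinj _ x.2 _ x'.2 (congrArg Subtype.val h)),
            fun y => by
              obtain ⟨x, hx, hxy⟩ := hsurj y.1 y.2
              exact ⟨⟨x, hx⟩, Subtype.ext hxy⟩⟩
        map_rel_iff' := fun {x x'} => hle x x' }
    refine ⟨a, (show openSub Y b ≅ openSub X a from (Frm.Iso.mk e).op), ?_⟩
    refine hom_ext fun x => Subtype.ext ?_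
    change pull f x ⊓ b = pull f (x ⊓ a) ⊓ b
    rw [map_inf, inf_assoc, inf_eq_right.mpr hb]

instance localHomeo_isMultiplicative : localHomeo.{u}.IsMultiplicative where
  id_mem X := ⟨{⊤}, sSup_singleton, by
    rintro b rfl
    exact ⟨⊤, Iso.refl _, by simp⟩⟩
  comp_mem {Z Y X} f g := by
    rintro ⟨S, hS, hf⟩ ⟨T, hT, hg⟩
    refine ⟨Set.image2 (fun z t => z ⊓ pull f t) S T, ?_, ?_⟩
    · have h1 : sSup (pull f '' T) = ⊤ := by rw [← map_sSup, hT, map_top]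
      have h2 : sSup S ⊓ sSup (pull f '' T) = ⊤ := by rw [hS, h1, inf_idem]
      rw [eq_top_iff, ← h2, sSup_inf_sSup]
      refine iSup₂_le fun p hp => ?_
      obtain ⟨hz, t, ht, hp2⟩ := hp
      rw [← hp2]
      exact le_sSup ⟨p.1, hz, t, ht, rfl⟩
    · rintro _ ⟨z, hz, t, ht, rfl⟩
      obtain ⟨v, hv, finj, fsurj⟩ := (isOpenInclusion_iff f z).mp (hf z hz)
      obtain ⟨w, hw, ginj, gsurj⟩ := (isOpenInclusion_iff g t).mp (hg t ht)
      obtain ⟨m, hm, hmt⟩ := gsurj (t ⊓ v) inf_le_left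
      have hcalc : ∀ x : X, pull (f ≫ g) x ⊓ (z ⊓ pull f t) =
          pull f (pull g x ⊓ t) ⊓ z := fun x => by
        rw [pull_comp, map_inf, inf_comm z, ← inf_assoc]
      have hlev : ∀ x ≤ m, pull g x ⊓ t ≤ v := fun x hx =>
        (inf_le_inf_right t (OrderHomClass.mono (pull g) hx)).trans (hmt.le.trans inf_le_right)
      refine (isOpenInclusion_iff (f ≫ g) _).mpr ⟨m, ?_, ?_, ?_⟩
      · have h1 : pull f (t ⊓ v) ≤ pull f (pull g m) :=
          OrderHomClass.mono (pull f) (hmt.symm.le.trans inf_le_left)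
        rw [map_inf] at h1
        exact (le_inf inf_le_right (inf_le_left.trans hv)).trans h1
      · intro x hx x' hx' h
        rw [hcalc, hcalc] at h
        exact ginj x (hx.trans hm) x' (hx'.trans hm) (finj _ (hlev x hx) _ (hlev x' hx') h)
      · intro y hy
        obtain ⟨a, hav, hay⟩ := fsurj y (hy.trans inf_le_left)
        have hat : a ≤ t := by
          have h1 : pull f (a ⊓ t) ⊓ z = pull f a ⊓ z := by
            rw [map_inf, inf_right_comm, hay]
            exact inf_eq_left.mpr (hy.trans inf_le_right)
          exact inf_eq_left.mp (finj _ (inf_le_left.trans hav) _ hav h1)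
        obtain ⟨c, hcw, hca⟩ := gsurj a hat
        have hcm : c ≤ m := by
          have h1 : pull g (c ⊓ m) ⊓ t = pull g c ⊓ t := by
            rw [map_inf, inf_inf_distrib_right, hmt, hca]
            exact inf_eq_left.mpr (le_inf hat hav)
          exact inf_eq_left.mp (ginj _ (inf_le_left.trans hcw) _ hcw h1)
        exact ⟨c, hcm, by rw [hcalc, hca, hay]⟩

/-- The slice category `LH/X`: its objects are the local homeomorphisms `Y ⟶ X`, and its
morphisms are the local homeomorphisms over `X`. -/
abbrev LHOver (X : Locale.{u}) := localHomeo.{u}.Over localHomeo.{u} X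

/-- The inclusion of `LH/X` in `Loc/X`. -/
abbrev LHOver.incl (X : Locale.{u}) : LHOver X ⥤ Over X :=
  MorphismProperty.Over.forget localHomeo localHomeo X

/-! ### Sheaves on a locale -/

/-- The Grothendieck topology on `O(X)`: a sieve on `a` covers if the join of its members
is `a`. -/
def topology (X : Locale.{u}) : GrothendieckTopology X where
  sieves a := {S | sSup {b : X | ∃ h : b ⟶ a, S h} = a}
  top_mem' a := le_antisymm (sSup_le fun _ ⟨h, _⟩ => leOfHom h) (le_sSup ⟨𝟙 a, trivial⟩)
  pullback_stable' a c S f hS := by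
    refine le_antisymm (sSup_le fun _ ⟨h, _⟩ => leOfHom h) ?_
    have h1 : c = c ⊓ sSup {b : X | ∃ h : b ⟶ a, S h} := by
      rw [show sSup {b : X | ∃ h : b ⟶ a, S h} = a from hS, inf_eq_left.mpr (leOfHom f)]
    refine h1.le.trans ?_
    rw [inf_sSup_eq]
    refine iSup₂_le fun b hb => le_sSup ⟨homOfLE inf_le_left, ?_⟩
    obtain ⟨h, hSh⟩ := hb
    exact S.downward_closed hSh (homOfLE inf_le_right)
  transitive' a S hS R hR := by
    refine le_antisymm (sSup_le fun _ ⟨h, _⟩ => leOfHom h) ?_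
    have h1 : a = sSup {b : X | ∃ h : b ⟶ a, S h} := Eq.symm hS
    refine h1.le.trans (sSup_le ?_)
    rintro b ⟨h, hSh⟩
    have h2 : b = sSup {c : X | ∃ k : c ⟶ b, R.pullback h k} := Eq.symm (hR hSh)
    refine h2.le.trans (sSup_le ?_)
    rintro c ⟨k, hk⟩
    exact le_sSup ⟨k ≫ h, hk⟩

/-- The category `[O(X)^op, Set]` of presheaves on `X`. -/
abbrev Psh (X : Locale.{u}) := (X : Type u)ᵒᵖ ⥤ Type u

/-- The category `Sh(X)` of sheaves on `X`. -/
abbrev Sh (X : Locale.{u}) := Sheaf (topology X) (Type u)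

/-- The inclusion of `Sh(X)` in `[O(X)^op, Set]`. -/
abbrev Sh.incl (X : Locale.{u}) : Sh X ⥤ Psh X := sheafToPresheaf (topology X) (Type u)

/-! ### The functor `Γ` of continuous sections -/

/-- `Γ : Loc/X ⥤ [O(X)^op, Set]`. The elements of `Γ(p)(a)` are the continuous sections of `p`
over `a`, i.e. the morphisms over `X` from the open inclusion `↓a ⟶ X` to `p`; restriction is
composition with the inclusion of `↓b` in `↓a`. -/
def Gam (X : Locale.{u}) : Over X ⥤ Psh X :=
  yoneda ⋙ (Functor.whiskeringLeft _ _ _).obj (openFunctor X).op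

/-! ### The functor `Λ` -/

section Lam

variable {X : Locale.{u}}

/-- The disjoint union of all the sets `P(a)`. -/
abbrev Elt (P : Psh X) : Type u := Σ a : X, P.obj (op a)

/-- `ε_P(s, t)`: the join of all `c` on which `s` and `t` are both defined and have the same
restriction. -/
def agree (P : Psh X) (s t : Elt P) : X :=
  sSup {c | ∃ (h : c ≤ s.1) (k : c ≤ t.1),
    P.map (homOfLE h).op s.2 = P.map (homOfLE k).op t.2}

/-- The underlying set of the frame `Λ(P)`. -/
def LamFrame (P : Psh X) : Type u :=
  {x : Elt P → X // (∀ s, x s ≤ s.1) ∧ ∀ s t, x s ⊓ agree P s t = x t ⊓ agree P s t}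

namespace LamFrame

variable {P : Psh X}

lemma agree_le_left (s t : Elt P) : agree P s t ≤ s.1 := sSup_le fun _ h => h.1
lemma agree_le_right (s t : Elt P) : agree P s t ≤ t.1 := sSup_le fun _ h => h.2.1

instance : CoeFun (LamFrame P) (fun _ => Elt P → X) := ⟨Subtype.val⟩

@[ext] lemma ext {x y : LamFrame P} (h : ∀ s, x s = y s) : x = y := Subtype.ext (funext h)

/-- The order of `Λ(P)` is pointwise. -/
instance : PartialOrder (LamFrame P) := Subtype.partialOrder _

instance : SupSet (LamFrame P) where
  sSup A := ⟨fun s => ⨆ x : A, x.1 s, fun s => iSup_le fun x => x.1.2.1 s, fun s t => by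
    rw [iSup_inf_eq, iSup_inf_eq]
    exact iSup_congr fun x => x.1.2.2 s t⟩

lemma isLUB_sSup (A : Set (LamFrame P)) : IsLUB A (sSup A) :=
  ⟨fun x hx s => le_iSup (fun x : A => x.1 s) ⟨x, hx⟩,
    fun _ hy s => iSup_le fun x => hy x.2 s⟩

instance : CompleteLattice (LamFrame P) where
  __ := completeLatticeOfSup (LamFrame P) isLUB_sSup
  inf x y := ⟨fun s => x s ⊓ y s, fun s => inf_le_left.trans (x.2.1 s), fun s t => by
    rw [inf_inf_distrib_right, x.2.2 s t, y.2.2 s t, ← inf_inf_distrib_right]⟩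
  inf_le_left _ _ _ := inf_le_left
  inf_le_right _ _ _ := inf_le_right
  le_inf _ _ _ h k s := le_inf (h s) (k s)
  top := ⟨fun s => s.1, fun _ => le_rfl, fun s t => by
    rw [inf_eq_right.mpr (agree_le_left s t), inf_eq_right.mpr (agree_le_right s t)]⟩
  le_top x s := x.2.1 s

@[simp] lemma inf_apply (x y : LamFrame P) (s : Elt P) : (x ⊓ y) s = x s ⊓ y s := rfl
@[simp] lemma top_apply (s : Elt P) : (⊤ : LamFrame P) s = s.1 := rfl
lemma sSup_apply (A : Set (LamFrame P)) (s : Elt P) : (sSup A) s = ⨆ x : A, x.1 s := rfl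

instance : Order.Frame (LamFrame P) :=
  Order.Frame.ofMinimalAxioms
    { inf_sSup_le_iSup_inf := fun x A s => by
        rw [inf_apply, sSup_apply, inf_iSup_eq]
        refine iSup_le fun y => ?_
        have h : x ⊓ y.1 ≤ ⨆ b ∈ A, x ⊓ b := le_iSup₂_of_le y.1 y.2 le_rfl
        exact h s }

end LamFrame

/-- The coordinate `x_s` of an element `x = (x_s)_s` of `Λ(P)`. -/
def LamFrame.coord {P : Psh X} (x : LamFrame P) (s : Elt P) : X := x.1 s

/-- The sheaf locale `Λ(P)` of a presheaf `P`. -/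
def lamLocale (P : Psh X) : Locale.{u} := Locale.of (LamFrame P)

/-- The frame homomorphism `p^* : O(X) → Λ(P)`, `x ↦ (x ⊓ u_s)_s`, where `s ∈ P(u_s)`. -/
def lamProjHom (P : Psh X) : FrameHom X (LamFrame P) where
  toFun x := ⟨fun s => x ⊓ s.1, fun _ => inf_le_right, fun s t => by
    rw [inf_assoc, inf_assoc, inf_eq_right.mpr (LamFrame.agree_le_left s t),
      inf_eq_right.mpr (LamFrame.agree_le_right s t)]⟩
  map_inf' x y := LamFrame.ext fun s => inf_inf_distrib_right x y s.1
  map_top' := LamFrame.ext fun s => top_inf_eq s.1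
  map_sSup' A := LamFrame.ext fun s => by
    change sSup A ⊓ s.1 = _
    rw [sSup_inf_eq, LamFrame.sSup_apply]
    apply le_antisymm
    · exact iSup₂_le fun x hx => le_iSup_of_le ⟨_, x, hx, rfl⟩ le_rfl
    · refine iSup_le ?_
      rintro ⟨_, x, hx, rfl⟩
      exact le_iSup₂_of_le x hx le_rfl

/-- The projection `p : Λ(P) ⟶ X`. -/
def lamProj (P : Psh X) : lamLocale P ⟶ X := ofPull (lamProjHom P)

/-- The action of a map of presheaves on the elements. -/
def Elt.map {P Q : Psh X} (α : P ⟶ Q) (s : Elt P) : Elt Q := ⟨s.1, α.app (op s.1) s.2⟩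

lemma agree_le_agree_map {P Q : Psh X} (α : P ⟶ Q) (s t : Elt P) :
    agree P s t ≤ agree Q (s.map α) (t.map α) := by
  refine sSup_le_sSup ?_
  rintro c ⟨h, k, e⟩
  refine ⟨h, k, ?_⟩
  have h1 := NatTrans.naturality_apply α (homOfLE h).op s.2
  have h2 := NatTrans.naturality_apply α (homOfLE k).op t.2
  exact h1.symm.trans ((congrArg _ e).trans h2)

/-- The frame homomorphism `Λ(α)^* : Λ(Q) → Λ(P)`, `x ↦ (x_{α(s)})_s`. -/
def lamMapHom {P Q : Psh X} (α : P ⟶ Q) : FrameHom (LamFrame Q) (LamFrame P) where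
  toFun x := ⟨fun s => x (s.map α), fun s => x.2.1 (s.map α), fun s t => by
    have h := congrArg (· ⊓ agree P s t) (x.2.2 (s.map α) (t.map α))
    simpa only [inf_assoc, inf_eq_right.mpr (agree_le_agree_map α s t)] using h⟩
  map_inf' _ _ := rfl
  map_top' := rfl
  map_sSup' A := LamFrame.ext fun s => by
    rw [LamFrame.sSup_apply (P := P)]
    apply le_antisymm
    · exact iSup_le fun x => le_iSup_of_le ⟨_, x.1, x.2, rfl⟩ le_rfl
    · refine iSup_le ?_
      rintro ⟨_, x, hx, rfl⟩
      exact le_iSup (fun x : A => x.1.1 (s.map α)) ⟨x, hx⟩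

variable (X)

/-- `Λ : [O(X)^op, Set] ⥤ Loc/X`. -/
def Lam : Psh X ⥤ Over X where
  obj P := Over.mk (lamProj P)
  map {P Q} α := Over.homMk (U := Over.mk (lamProj P)) (V := Over.mk (lamProj Q))
    (ofPull (X := lamLocale Q) (Y := lamLocale P) (lamMapHom α)) rfl
  map_id P := by
    ext1
    refine hom_ext fun x => LamFrame.ext fun s => ?_
    change x.1 (s.map (𝟙 P)) = x.1 s
    simp [Elt.map]
  map_comp {P Q R} α β := by
    ext1
    refine hom_ext fun x => LamFrame.ext fun s => ?_
    change x.1 (s.map (α ≫ β)) = x.1 ((s.map α).map β)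
    rfl

end Lam

end SheafLocale

open SheafLocale

/-!
A continuous section `s` of `f : Y ⟶ X` over `a` is handled through its inverse image map `secPull s`,
`y ↦ s^* y`, taken with values in `O(X)`; equality and gluing of sections are then statements about
opens of `X`. The unit and counit given by `p_s^* x = x_s` and `y ↦ (s^* y)_s` satisfy the triangle
identities by unfolding, which gives the adjunction `lamGamAdj : Λ ⊣ Γ`. The rest is to see where the
unit and the counit are invertible.

*Counit.* If `f` is a local homeomorphism, each open piece `b` of `Y` is the image of a section `s_b`
over some open of `X`, characterised by `f^* (s_b^* y) ⊓ b = y ⊓ b`, so an open of `Y` is determined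
by its inverse images under sections. Conversely a family `(x_s)` in `ΛΓ(f)` comes from
`⨆ b, f^* (x_{s_b}) ⊓ b`, because an arbitrary section `t` agrees with `s_b` on `t^* b`
(`secPull_le_agree`, `counitHom_bijective`).

*Unit.* For an element `s` of a presheaf `P`, the family `(ε_P(s, t))_t` is an open `imageOpen s` of
`Λ(P)`, the image of the section `p_s`. These opens cover `Λ(P)`, and on `imageOpen s` every open `x`
is pulled back from `x_s`; hence `Λ(P)` is a local homeomorphism over `X` (`localHomeo_lamProj`). If
`F` is a sheaf, a section `r` of `Λ(F)` coincides with `p_s` on `r^* (imageOpen s)`; on overlaps the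
corresponding `s` agree, so they glue to an element `g` with `p_g = r` (`lamUnit_bijective`).

Moreover `Γ(f)` is always a sheaf (`isSheaf_Gam`), and a map over `X` between local homeomorphisms is
a local homeomorphism (`localHomeo_of_postcomp`), so that both subcategories are full. The adjunction
therefore restricts to `Sh(X)` and `LH/X`, where unit and counit are isomorphisms; composing the
resulting equivalence with the adjunction between `Sh(X)` and `Loc/X` yields the coreflection.
The reflection of presheaves in `Sh(X)` is sheafification.
-/

namespace SheafLocale

variable {X : Locale.{u}}

/-! ### Continuous sections as maps of opens -/

/-- The frame homomorphism `s^* : O(Y) → ↓a` of a continuous section `s` of `f : Y ⟶ X`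
over `a`. -/
def secHom {f : Over X} {a : X} (s : Over.mk (openIncl X a) ⟶ f) :
    FrameHom f.left (Set.Iic a) :=
  pull s.left

/-- The inverse image map `y ↦ s^* y` of a continuous section `s` of `f` over `a`, with values in
`O(X)` rather than in `↓a`. -/
def secPull {f : Over X} {a : X} (s : Over.mk (openIncl X a) ⟶ f) (y : f.left) : X :=
  (secHom s y).1

section secPull

variable {f : Over X} {a : X} (s t : Over.mk (openIncl X a) ⟶ f)

lemma secPull_le (y : f.left) : secPull s y ≤ a := (secHom s y).2

lemma secPull_inf (y z : f.left) : secPull s (y ⊓ z) = secPull s y ⊓ secPull s z :=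
  congrArg Subtype.val (map_inf (secHom s) y z)

lemma secPull_top : secPull s ⊤ = a := congrArg Subtype.val (map_top (secHom s))

lemma secPull_sSup (A : Set f.left) : secPull s (sSup A) = ⨆ y ∈ A, secPull s y := by
  have h : secPull s (sSup A) = sSup ((↑) '' (secHom s '' A)) :=
    congrArg Subtype.val (map_sSup (secHom s) A)
  rw [h, Set.image_image, sSup_image]
  rfl

lemma secPull_iSup {ι : Type*} (y : ι → f.left) :
    secPull s (⨆ i, y i) = ⨆ i, secPull s (y i) := by
  rw [iSup, secPull_sSup, iSup_range]

lemma secPull_mono {y z : f.left} (h : y ≤ z) : secPull s y ≤ secPull s z :=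
  OrderHomClass.mono (secHom s) h

lemma secPull_base (x : X) : secPull s (pull f.hom x) = x ⊓ a :=
  congrArg (fun k : openSub X a ⟶ X => (pull k x : Set.Iic a).1) (Over.w s)

variable {s t} in
lemma secPull_ext (h : ∀ y, secPull s y = secPull t y) : s = t :=
  Over.OverMorphism.ext (hom_ext fun y => Subtype.ext (h y))

/-- The continuous section whose inverse image map is a given `φ`. -/
def mkSec (f : Over X) (a : X) (φ : f.left → X) (le : ∀ y, φ y ≤ a)
    (inf : ∀ y z, φ (y ⊓ z) = φ y ⊓ φ z) (top : φ ⊤ = a)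
    (sup : ∀ A : Set f.left, φ (sSup A) = ⨆ y ∈ A, φ y)
    (base : ∀ x, φ (pull f.hom x) = x ⊓ a) : Over.mk (openIncl X a) ⟶ f :=
  Over.homMk (U := Over.mk (openIncl X a))
    (ofPull (X := f.left) (Y := openSub X a)
      ({ toFun := fun y => ⟨φ y, le y⟩
         map_inf' := fun y z => Subtype.ext (inf y z)
         map_top' := Subtype.ext top
         map_sSup' := fun A => Subtype.ext (by
          change φ (sSup A) = sSup ((↑) '' ((fun y => (⟨φ y, le y⟩ : Set.Iic a)) '' A))
          rw [sup, Set.image_image, sSup_image]) } : FrameHom f.left (Set.Iic a)))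
    (hom_ext fun x => Subtype.ext (base x))

end secPull

/-! ### The open where two elements of a presheaf agree -/

section agree

variable {P : Psh X}

lemma le_agree {s t : Elt P} {c : X} (h : c ≤ s.1) (k : c ≤ t.1)
    (e : P.map (homOfLE h).op s.2 = P.map (homOfLE k).op t.2) : c ≤ agree P s t :=
  le_sSup ⟨h, k, e⟩

lemma agree_self (s : Elt P) : agree P s s = s.1 :=
  le_antisymm (LamFrame.agree_le_left s s) (le_agree le_rfl le_rfl rfl)

lemma agree_comm (s t : Elt P) : agree P s t = agree P t s :=
  le_antisymm (sSup_le fun _ ⟨h, k, e⟩ => le_agree k h e.symm)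
    (sSup_le fun _ ⟨h, k, e⟩ => le_agree k h e.symm)

lemma map_map_le (P : Psh X) {a b c : X} (h : b ≤ a) (k : c ≤ b) (l : c ≤ a)
    (s : P.obj (op a)) :
    P.map (homOfLE k).op (P.map (homOfLE h).op s) = P.map (homOfLE l).op s :=
  (Functor.map_comp_apply P (homOfLE h).op (homOfLE k).op s).symm

lemma agree_trans (s t r : Elt P) : agree P s t ⊓ agree P t r ≤ agree P s r := by
  change sSup _ ⊓ sSup _ ≤ _
  rw [sSup_inf_sSup]
  refine iSup₂_le ?_
  rintro ⟨c, d⟩ ⟨⟨h, k, e⟩, ⟨h', k', e'⟩⟩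
  refine le_agree (inf_le_left.trans h) (inf_le_right.trans k') ?_
  have e₁ := congrArg (P.map (homOfLE (inf_le_left : c ⊓ d ≤ c)).op) e
  have e₂ := congrArg (P.map (homOfLE (inf_le_right : c ⊓ d ≤ d)).op) e'
  rw [map_map_le P h _ (inf_le_left.trans h), map_map_le P k _ (inf_le_left.trans k)] at e₁
  rw [map_map_le P h' _ (inf_le_right.trans h'), map_map_le P k' _ (inf_le_right.trans k')] at e₂
  exact e₁.trans e₂

lemma le_agree_restrict {a b : X} (h : b ≤ a) (s : P.obj (op a)) :
    b ≤ agree P ⟨b, P.map (homOfLE h).op s⟩ ⟨a, s⟩ :=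
  le_agree le_rfl h (map_map_le P h le_rfl h s)

lemma LamFrame.inf_eq_inf {s t : Elt P} (x : LamFrame P) {c : X} (h : c ≤ agree P s t) :
    x s ⊓ c = x t ⊓ c := by
  have e := congrArg (· ⊓ c) (x.2.2 s t)
  simpa only [inf_assoc, inf_eq_right.mpr h] using e

lemma LamFrame.apply_restrict (x : LamFrame P) {a b : X} (h : b ≤ a) (s : P.obj (op a)) :
    x ⟨b, P.map (homOfLE h).op s⟩ = x ⟨a, s⟩ ⊓ b := by
  rw [← x.inf_eq_inf (le_agree_restrict h s)]
  exact (inf_eq_left.mpr (x.2.1 _)).symm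

end agree

/-! ### The adjunction between `Λ` and `Γ` -/

/-- The section `p_s` of `Λ(P)` given by an element `s` of `P`; its inverse image map is the
coordinate at `s`. -/
def unitSec (P : Psh X) (a : X) (s : P.obj (op a)) :
    Over.mk (openIncl X a) ⟶ Over.mk (lamProj P) :=
  mkSec (Over.mk (lamProj P)) a (fun x : LamFrame P => x ⟨a, s⟩) (fun x => x.2.1 _)
    (fun _ _ => rfl) rfl
    (fun A => by rw [← iSup_subtype'']; rfl)
    (fun _ => rfl)

/-- The unit `P ⟶ ΓΛ(P)`, `s ↦ p_s`. -/
def lamUnit (P : Psh X) : P ⟶ (Gam X).obj ((Lam X).obj P) where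
  app a := TypeCat.ofHom fun s => unitSec P a.unop s
  naturality a b h := by
    ext s
    exact secPull_ext fun x => LamFrame.apply_restrict x (leOfHom h.unop) s

lemma agree_Gam_le (f : Over X) (y : f.left) (s t : Elt ((Gam X).obj f)) :
    secPull s.2 y ⊓ agree _ s t ≤ secPull t.2 y := by
  change _ ⊓ sSup _ ≤ _
  rw [inf_sSup_eq]
  refine iSup₂_le ?_
  rintro c ⟨h, k, e⟩
  have := congrArg (fun r => secPull r y) e
  exact (this.le : secPull s.2 y ⊓ c ≤ secPull t.2 y ⊓ c).trans inf_le_left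

/-- The frame homomorphism `O(Y) → ΛΓ(f)`, `y ↦ (s^* y)_s`, for `f : Y ⟶ X`. -/
def counitHom (f : Over X) : FrameHom f.left (LamFrame ((Gam X).obj f)) where
  toFun y := ⟨fun s => secPull s.2 y, fun s => secPull_le s.2 y, fun s t =>
    le_antisymm (le_inf (agree_Gam_le f y s t) inf_le_right)
      (le_inf (by rw [agree_comm]; exact agree_Gam_le f y t s) inf_le_right)⟩
  map_inf' y z := LamFrame.ext fun s => secPull_inf s.2 y z
  map_top' := LamFrame.ext fun s => secPull_top s.2
  map_sSup' A := LamFrame.ext fun s => by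
    refine (secPull_sSup s.2 A).trans ?_
    rw [LamFrame.sSup_apply]
    apply le_antisymm
    · exact iSup₂_le fun y hy => le_iSup_of_le ⟨_, y, hy, rfl⟩ le_rfl
    · refine iSup_le ?_
      rintro ⟨_, y, hy, rfl⟩
      exact le_iSup₂_of_le y hy le_rfl

/-- The counit `ΛΓ(f) ⟶ f`. -/
def lamCounit (f : Over X) : (Lam X).obj ((Gam X).obj f) ⟶ f :=
  Over.homMk (U := Over.mk (lamProj ((Gam X).obj f)))
    (ofPull (X := f.left) (Y := lamLocale ((Gam X).obj f)) (counitHom f))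
    (hom_ext fun x => LamFrame.ext fun s => secPull_base s.2 x)

variable (X) in
/-- The adjunction `Λ ⊣ Γ`. -/
def lamGamAdj : Lam X ⊣ Gam X :=
  Adjunction.mkOfUnitCounit
    { unit :=
        { app := lamUnit
          naturality := fun P Q α => by
            ext a s
            exact secPull_ext fun x => rfl }
      counit :=
        { app := lamCounit
          naturality := fun f g k => by
            ext1
            exact hom_ext fun y => LamFrame.ext fun s => rfl }
      left_triangle := by
        ext P
        exact hom_ext fun x => LamFrame.ext fun s => rfl
      right_triangle := by
        ext f a s
        exact secPull_ext fun y => rfl }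

/-! ### Cancellation of local homeomorphisms -/

/-- If `g` and `g ∘ f` are local homeomorphisms, then so is `f`; hence every map over `X` between
local homeomorphisms is one. -/
lemma localHomeo_of_postcomp {Z Y : Locale.{u}} (f : Z ⟶ Y) (g : Y ⟶ X)
    (hg : localHomeo g) (hfg : localHomeo (f ≫ g)) : localHomeo f := by
  obtain ⟨S, hS, hfg⟩ := hfg
  obtain ⟨T, hT, hg⟩ := hg
  refine ⟨Set.image2 (fun z t => z ⊓ pull f t) S T, ?_, ?_⟩
  · have h1 : sSup (pull f '' T) = ⊤ := by rw [← map_sSup, hT, map_top]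
    have h2 : sSup S ⊓ sSup (pull f '' T) = ⊤ := by rw [hS, h1, inf_idem]
    rw [eq_top_iff, ← h2, sSup_inf_sSup]
    refine iSup₂_le fun p hp => ?_
    obtain ⟨hz, t, ht, hp2⟩ := hp
    rw [← hp2]
    exact le_sSup ⟨p.1, hz, t, ht, rfl⟩
  · rintro _ ⟨b, hb, t, ht, rfl⟩
    obtain ⟨v, hv, finj, fsurj⟩ := (isOpenInclusion_iff (f ≫ g) b).mp (hfg b hb)
    obtain ⟨w, hw, ginj, gsurj⟩ := (isOpenInclusion_iff g t).mp (hg t ht)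
    -- `m` is the image of `b ⊓ f^* t` in `X`; its part in `t` is the image of `b ⊓ f^* t` in `Y`.
    obtain ⟨m, hm, hmz⟩ := fsurj (b ⊓ pull f t) inf_le_left
    have hmg : b ⊓ pull f t ≤ pull f (pull g m) := hmz.symm.le.trans inf_le_left
    have hlift : ∀ y ≤ pull g m ⊓ t, ∃ x ≤ m, pull g x ⊓ t = y := fun y hy => by
      obtain ⟨x, -, rfl⟩ := gsurj y (hy.trans inf_le_right)
      refine ⟨x ⊓ m, inf_le_right, ?_⟩
      rw [map_inf, inf_right_comm]
      exact inf_eq_left.mpr (hy.trans inf_le_left)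
    have hcalc : ∀ x ≤ m, pull f (pull g x ⊓ t) ⊓ (b ⊓ pull f t) = pull (f ≫ g) x ⊓ b := by
      intro x hx
      have h1 : pull (f ≫ g) x ⊓ b ≤ b ⊓ pull f t :=
        (inf_le_inf_right b (OrderHomClass.mono (pull (f ≫ g)) hx)).trans hmz.le
      rw [map_inf, ← pull_comp]
      refine le_antisymm (le_inf (inf_le_left.trans inf_le_left) (inf_le_right.trans inf_le_left))
        (le_inf (le_inf inf_le_left (h1.trans inf_le_right)) h1)
    refine (isOpenInclusion_iff f _).mpr ⟨pull g m ⊓ t, ?_, ?_, ?_⟩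
    · rw [map_inf]
      exact le_inf hmg inf_le_right
    · intro y hy y' hy' h
      obtain ⟨x, hx, rfl⟩ := hlift y hy
      obtain ⟨x', hx', rfl⟩ := hlift y' hy'
      rw [hcalc x hx, hcalc x' hx'] at h
      rw [finj x (hx.trans hm) x' (hx'.trans hm) h]
    · intro z hz
      obtain ⟨x, hx, hxz⟩ := fsurj z (hz.trans inf_le_left)
      have hxm : x ≤ m := by
        refine inf_eq_left.mp (finj _ (inf_le_left.trans hx) _ hx ?_)
        rw [map_inf, inf_inf_distrib_right, hmz, hxz]
        exact inf_eq_left.mpr hz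
      refine ⟨pull g x ⊓ t, inf_le_inf_right t (OrderHomClass.mono (pull g) hxm), ?_⟩
      rw [hcalc x hxm, hxz]

/-! ### The projection of `Λ(P)` is a local homeomorphism -/

section imageOpen

variable {P : Psh X}

/-- The open of `Λ(P)` swept out by the section `p_s`: its coordinate at `t` is the open where
`s` and `t` agree. -/
def imageOpen (s : Elt P) : LamFrame P :=
  ⟨fun t => agree P s t, fun t => LamFrame.agree_le_right s t, fun t r =>
    le_antisymm (le_inf (agree_trans s t r) inf_le_right)
      (le_inf (by rw [agree_comm t r]; exact agree_trans s r t) inf_le_right)⟩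

lemma sSup_range_imageOpen : sSup (Set.range (imageOpen (P := P))) = ⊤ := by
  refine eq_top_iff.mpr fun t => ?_
  have h : imageOpen t ≤ sSup (Set.range (imageOpen (P := P))) := le_sSup ⟨t, rfl⟩
  exact (agree_self t).symm.le.trans (h t)

lemma imageOpen_le (s : Elt P) : imageOpen s ≤ lamProjHom P s.1 := fun t =>
  le_inf (LamFrame.agree_le_left s t) (LamFrame.agree_le_right s t)

lemma imageOpen_inf_le (s t : Elt P) :
    imageOpen s ⊓ imageOpen t ≤ lamProjHom P (agree P s t) := fun r =>
  le_inf ((inf_le_inf_left _ (agree_comm t r).le).trans (agree_trans s r t))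
    (inf_le_left.trans (LamFrame.agree_le_right s r))

/-- On the image of `p_s`, an open of `Λ(P)` is pulled back from its coordinate at `s`. -/
lemma lamProjHom_inf_imageOpen (x : LamFrame P) (s : Elt P) :
    lamProjHom P (x s) ⊓ imageOpen s = x ⊓ imageOpen s := by
  refine LamFrame.ext fun t => ?_
  change x s ⊓ t.1 ⊓ agree P s t = x t ⊓ agree P s t
  rw [inf_assoc, inf_eq_right.mpr (LamFrame.agree_le_right s t), x.2.2 s t]

end imageOpen

lemma localHomeo_lamProj (P : Psh X) : localHomeo (lamProj P) := by
  refine ⟨Set.range (imageOpen (P := P)), sSup_range_imageOpen, ?_⟩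
  rintro _ ⟨s, rfl⟩
  refine (isOpenInclusion_iff (lamProj P) _).mpr ⟨s.1, imageOpen_le s, ?_, ?_⟩
  · intro x hx x' hx' h
    have h1 : x ⊓ s.1 ⊓ agree P s s = x' ⊓ s.1 ⊓ agree P s s :=
      congrArg (fun y : LamFrame P => y s) h
    rwa [agree_self, inf_assoc, inf_assoc, inf_idem, inf_eq_left.mpr hx,
      inf_eq_left.mpr hx'] at h1
  · intro (y : LamFrame P) hy
    exact ⟨y s, y.2.1 s, (lamProjHom_inf_imageOpen y s).trans (inf_eq_left.mpr hy)⟩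

/-! ### The counit at a local homeomorphism -/

/-- If `f` restricts to an open inclusion on `b`, then `b` is the image of a continuous section
of `f`: on `b`, an open of `Y` is pulled back from its inverse image under the section. -/
lemma exists_section_of_isOpenInclusion (f : Over X) (b : f.left)
    (h : IsOpenInclusion (openIncl f.left b ≫ f.hom)) :
    ∃ (a : X) (s : Over.mk (openIncl X a) ⟶ f), b ≤ pull f.hom a ∧
      ∀ y, pull f.hom (secPull s y) ⊓ b = y ⊓ b := by
  obtain ⟨a, hb, hinj, hsurj⟩ := (isOpenInclusion_iff f.hom b).mp h
  choose φ hφa hφ using fun y : f.left => hsurj (y ⊓ b) inf_le_right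
  refine ⟨a, mkSec f a φ hφa ?_ ?_ ?_ ?_, hb, hφ⟩
  · intro y z
    refine hinj _ (hφa _) _ (inf_le_left.trans (hφa y)) ?_
    rw [hφ, map_inf (pull f.hom), inf_inf_distrib_right y, inf_inf_distrib_right (pull f.hom (φ y)),
      hφ, hφ]
  · refine hinj _ (hφa _) _ le_rfl ?_
    rw [hφ, top_inf_eq, inf_eq_right.mpr hb]
  · intro A
    refine hinj _ (hφa _) _ (iSup₂_le fun y _ => hφa y) ?_
    rw [hφ, map_iSup₂, iSup₂_inf_eq, sSup_inf_eq]
    exact iSup_congr fun y => iSup_congr fun _ => (hφ y).symm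
  · intro x
    refine hinj _ (hφa _) _ inf_le_right ?_
    rw [hφ, map_inf, inf_assoc, inf_eq_right.mpr hb]

/-- Let `b` be the image of the section `s`. Then any section `t` agrees with `s` wherever it
lands in `b`. -/
lemma secPull_le_agree {f : Over X} {b : f.left} {a c : X} (s : Over.mk (openIncl X a) ⟶ f)
    (hb : b ≤ pull f.hom a) (hs : ∀ y, pull f.hom (secPull s y) ⊓ b = y ⊓ b)
    (t : Over.mk (openIncl X c) ⟶ f) :
    secPull t b ≤ agree ((Gam X).obj f) ⟨a, s⟩ ⟨c, t⟩ := by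
  have hta : secPull t b ≤ a :=
    (secPull_mono t hb).trans ((secPull_base t a).le.trans inf_le_left)
  refine le_agree (P := (Gam X).obj f) (s := ⟨a, s⟩) (t := ⟨c, t⟩) hta (secPull_le t b)
    (secPull_ext fun y => ?_)
  change secPull s y ⊓ secPull t b = secPull t y ⊓ secPull t b
  have h := congrArg (secPull t) (hs y)
  rw [secPull_inf, secPull_inf, secPull_base, inf_assoc, inf_eq_right.mpr (secPull_le t b)] at h
  exact h

lemma counitHom_bijective (f : Over X) (hf : localHomeo f.hom) :
    Function.Bijective (counitHom f) := by
  obtain ⟨S, hS, hf⟩ := hf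
  choose a s hb hs using fun b : S => exists_section_of_isOpenInclusion f b.1 (hf b.1 b.2)
  constructor
  · intro y z h
    have key : ∀ b ∈ S, y ⊓ b = z ⊓ b := fun b hb' => by
      have e : secPull (s ⟨b, hb'⟩) y = secPull (s ⟨b, hb'⟩) z :=
        congrArg (fun x : LamFrame ((Gam X).obj f) => x ⟨a ⟨b, hb'⟩, s ⟨b, hb'⟩⟩) h
      rw [← hs ⟨b, hb'⟩ y, ← hs ⟨b, hb'⟩ z, e]
    rw [← inf_top_eq y, ← inf_top_eq z, ← hS, inf_sSup_eq, inf_sSup_eq]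
    exact iSup_congr fun b => iSup_congr (key b)
  · intro x
    -- on the piece `b`, the open with inverse image `x_{s_b}` under `s_b` is `f^* x_{s_b} ⊓ b`
    refine ⟨⨆ b : S, pull f.hom (x ⟨a b, s b⟩) ⊓ b, LamFrame.ext ?_⟩
    rintro ⟨c, (t : Over.mk (openIncl X c) ⟶ f)⟩
    refine (secPull_iSup t _).trans ?_
    calc ⨆ b : S, secPull t (pull f.hom (x ⟨a b, s b⟩) ⊓ b)
        = ⨆ b : S, x ⟨c, t⟩ ⊓ secPull t b := iSup_congr fun b => by
          rw [secPull_inf, secPull_base, inf_assoc, inf_eq_right.mpr (secPull_le t _)]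
          exact x.inf_eq_inf (secPull_le_agree (s b) (hb b) (hs b) t)
      _ = x ⟨c, t⟩ ⊓ secPull t (⨆ b : S, b.1) := by rw [← inf_iSup_eq, secPull_iSup]
      _ = x ⟨c, t⟩ := by
          rw [← sSup_eq_iSup', hS, secPull_top]
          exact inf_eq_left.mpr (x.2.1 _)

/-- A localic map whose inverse image map is bijective is an isomorphism. -/
lemma isIso_of_pull_bijective {Z Y : Locale.{u}} (f : Z ⟶ Y)
    (h : Function.Bijective (pull f)) : IsIso f := by
  let e : Y ≃o Z :=
    { toEquiv := Equiv.ofBijective (pull f) h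
      map_rel_iff' := fun {x y} => by
        refine ⟨fun hxy => inf_eq_left.mp (h.1 ?_), fun hxy => OrderHomClass.mono (pull f) hxy⟩
        rw [map_inf]
        exact inf_eq_left.mpr hxy }
  let i : Z ≅ Y := (Frm.Iso.mk e).op
  exact (show f = i.hom from rfl) ▸ i.isIso_hom

lemma isIso_lamCounit (f : Over X) (hf : localHomeo f.hom) : IsIso (lamCounit f) := by
  have : IsIso ((Over.forget X).map (lamCounit f)) :=
    isIso_of_pull_bijective (lamCounit f).left (counitHom_bijective f hf)
  exact isIso_of_reflects_iso (lamCounit f) (Over.forget X)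

/-! ### Sections form a sheaf -/

lemma isSheaf_Gam (f : Over X) : Presheaf.IsSheaf (topology X) ((Gam X).obj f) := by
  rw [isSheaf_iff_isSheaf_of_type]
  intro a S hS x hx
  have hcov : ⨆ i : {b : X // ∃ h : b ⟶ a, S h}, i.1 = a := (sSup_eq_iSup' _).symm.trans hS
  let r : ∀ i : {b : X // ∃ h : b ⟶ a, S h}, Over.mk (openIncl X i.1) ⟶ f :=
    fun i => x i.2.choose i.2.choose_spec
  have hr : ∀ i j y, secPull (r i) y ⊓ j.1 ≤ secPull (r j) y := by
    intro i j y
    have h := hx (homOfLE (inf_le_left : i.1 ⊓ j.1 ≤ i.1)) (homOfLE inf_le_right)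
      i.2.choose_spec j.2.choose_spec (Subsingleton.elim _ _)
    have h' : secPull (r i) y ⊓ (i.1 ⊓ j.1) = secPull (r j) y ⊓ (i.1 ⊓ j.1) :=
      congrArg (fun r => secPull r y) h
    rw [← inf_assoc, inf_eq_left.mpr (secPull_le (r i) y)] at h'
    exact h'.le.trans inf_le_left
  have hglue : ∀ y i, (⨆ j, secPull (r j) y) ⊓ i.1 = secPull (r i) y := fun y i => by
    refine le_antisymm ?_ (le_inf (le_iSup (fun j => secPull (r j) y) i) (secPull_le _ _))
    rw [iSup_inf_eq]
    exact iSup_le fun j => hr j i y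
  refine ⟨mkSec f a (fun y => ⨆ i, secPull (r i) y) ?_ ?_ ?_ ?_ ?_, ?_, ?_⟩
  · exact fun y => iSup_le fun i => (secPull_le _ _).trans (leOfHom i.2.choose)
  · intro y z
    refine le_antisymm (le_inf (iSup_mono fun i => secPull_mono _ inf_le_left)
      (iSup_mono fun i => secPull_mono _ inf_le_right)) ?_
    rw [inf_iSup_eq]
    refine iSup_mono fun i => ?_
    rw [secPull_inf, ← hglue y i, inf_assoc, inf_eq_right.mpr (secPull_le (r i) z)]
  · simp only [secPull_top]
    exact hcov
  · intro A
    simp only [secPull_sSup]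
    rw [iSup_comm]
    exact iSup_congr fun y => iSup_comm
  · intro z
    simp only [secPull_base]
    rw [← inf_iSup_eq, hcov]
  · intro b h hb
    refine secPull_ext fun y => ?_
    -- `r` picks some morphism `b ⟶ a` in `S`, which is equal to `h` but not definitionally
    have hxr : ∀ (k : b ⟶ a) (hk : S k), x k hk = x h hb := fun k hk => by
      obtain rfl : k = h := Subsingleton.elim _ _
      rfl
    exact (hglue y ⟨b, h, hb⟩).trans (congrArg (fun q => secPull q y) (hxr _ _))
  · intro t ht
    refine secPull_ext fun y => ?_
    have h : ∀ i, secPull t y ⊓ i.1 = secPull (r i) y := fun i =>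
      congrArg (fun q => secPull q y) (ht i.2.choose i.2.choose_spec)
    change secPull t y = ⨆ i, secPull (r i) y
    simp only [← h]
    rw [← inf_iSup_eq, hcov]
    exact (inf_eq_left.mpr (secPull_le t y)).symm

/-! ### The unit at a sheaf -/

section sheaf

variable {F : Psh X} (hF : Presheaf.IsSheaf (topology X) F)
include hF

lemma restrict_eq_of_le_agree {s t : Elt F} {c : X} (h : c ≤ s.1) (k : c ≤ t.1)
    (hc : c ≤ agree F s t) : F.map (homOfLE h).op s.2 = F.map (homOfLE k).op t.2 := by
  have hF' := (isSheaf_iff_isSheaf_of_type _ _).mp hF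
  let S : Sieve c :=
    { arrows := fun b l => F.map l.op (F.map (homOfLE h).op s.2) =
        F.map l.op (F.map (homOfLE k).op t.2)
      downward_closed := fun {b d} l e m => by
        simp only [op_comp, Functor.map_comp_apply]
        rw [e] }
  refine (hF'.isSeparated S ?_).ext fun b l e => e
  refine le_antisymm (sSup_le fun _ ⟨l, _⟩ => leOfHom l) ?_
  refine (inf_eq_left.mpr hc).symm.le.trans ?_
  change _ ⊓ sSup _ ≤ _
  rw [inf_sSup_eq]
  refine iSup₂_le ?_
  rintro d ⟨hd, kd, e⟩
  refine le_sSup ⟨homOfLE inf_le_left, ?_⟩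
  have := congrArg (F.map (homOfLE (inf_le_right : c ⊓ d ≤ d)).op) e
  rw [map_map_le F hd _ (inf_le_right.trans hd), map_map_le F kd _ (inf_le_right.trans kd)] at this
  exact (map_map_le F h inf_le_left _ s.2).trans (this.trans (map_map_le F k inf_le_left _ t.2).symm)

/-- Elements that agree on the overlaps of a cover glue. -/
lemma exists_glue {ι : Type*} (s : ι → Elt F) (c : ι → X) (a : X) (hc : ∀ i, c i ≤ (s i).1)
    (ha : ⨆ i, c i = a) (h : ∀ i j, c i ⊓ c j ≤ agree F (s i) (s j)) :
    ∃ g : F.obj (op a), ∀ i, c i ≤ agree F ⟨a, g⟩ (s i) := by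
  have hF' := (isSheaf_iff_isSheaf_of_type _ _).mp hF
  have hca : ∀ i, c i ≤ a := fun i => ha ▸ le_iSup c i
  let S : Sieve a :=
    { arrows := fun b _ => ∃ i, b ≤ c i
      downward_closed := fun {b d} _ ⟨i, hi⟩ m => ⟨i, (leOfHom m).trans hi⟩ }
  have hS : S ∈ topology X a := by
    refine le_antisymm (sSup_le fun _ ⟨l, _⟩ => leOfHom l) ?_
    exact ha.symm.le.trans (iSup_le fun i => le_sSup ⟨homOfLE (hca i), i, le_rfl⟩)
  let x : Presieve.FamilyOfElements F S.arrows := fun b _ hb =>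
    F.map (homOfLE (hb.choose_spec.trans (hc hb.choose))).op (s hb.choose).2
  have hx : x.Compatible := by
    intro b b' d l l' m m' hm hm' _
    have e := restrict_eq_of_le_agree hF
      (((leOfHom l).trans hm.choose_spec).trans (hc hm.choose))
      (((leOfHom l').trans hm'.choose_spec).trans (hc hm'.choose))
      ((le_inf ((leOfHom l).trans hm.choose_spec)
        ((leOfHom l').trans hm'.choose_spec)).trans (h hm.choose hm'.choose))
    exact (map_map_le F _ (leOfHom l) _ _).trans (e.trans (map_map_le F _ (leOfHom l') _ _).symm)
  obtain ⟨g, hg, -⟩ := hF' S hS x hx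
  refine ⟨g, fun i => ?_⟩
  have hi : S (homOfLE (hca i)) := ⟨i, le_rfl⟩
  have e : F.map (homOfLE (hca i)).op g = x (homOfLE (hca i)) hi := hg _ hi
  refine le_agree (s := ⟨a, g⟩) (hca i) (hc i) (e.trans ?_)
  -- the index chosen by `x` need not be `i`, but both elements agree on `c i`
  exact restrict_eq_of_le_agree hF _ _ ((le_inf hi.choose_spec le_rfl).trans (h hi.choose i))

/-- Every continuous section `r` of `Λ(F)` is some `p_g`: it lands in the image of `p_s` on
`c_s = r^*(imageOpen s)`, and the restrictions of the `s` to the `c_s` glue to `g`. -/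
lemma lamUnit_bijective (a : X) : Function.Bijective ((lamUnit F).app (op a)) := by
  constructor
  · intro s t h
    have e : agree F ⟨a, s⟩ ⟨a, s⟩ = agree F ⟨a, s⟩ ⟨a, t⟩ :=
      congrArg (fun r : Over.mk (openIncl X a) ⟶ Over.mk (lamProj F) =>
        secPull r (imageOpen ⟨a, s⟩)) h
    rw [agree_self] at e
    have := restrict_eq_of_le_agree hF (s := ⟨a, s⟩) (t := ⟨a, t⟩) le_rfl le_rfl e.le
    have hid : ∀ z : F.obj (op a), F.map (homOfLE (le_refl a)).op z = z :=
      fun z => Functor.map_id_apply F (op a) z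
    exact (hid s).symm.trans (this.trans (hid t))
  · intro (r : Over.mk (openIncl X a) ⟶ Over.mk (lamProj F))
    let c : Elt F → X := fun s => secPull r (imageOpen s)
    have hbase : ∀ x : X, secPull r (lamProjHom F x) = x ⊓ a := secPull_base r
    have htop : ⨆ s, c s = a := by
      have h := secPull_iSup r (fun s : Elt F => (imageOpen s : LamFrame F))
      exact h.symm.trans ((congrArg (secPull r) sSup_range_imageOpen).trans (secPull_top r))
    obtain ⟨g, hg⟩ := exists_glue hF id c a
      (fun s => (secPull_mono r (imageOpen_le s)).trans ((hbase _).le.trans inf_le_left)) htop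
      (fun s t => (secPull_inf r _ _).symm.le.trans
        ((secPull_mono r (imageOpen_inf_le s t)).trans ((hbase _).le.trans inf_le_left)))
    refine ⟨g, secPull_ext fun (x : LamFrame F) => ?_⟩
    change x ⟨a, g⟩ = secPull r x
    have key : ∀ s, x ⟨a, g⟩ ⊓ c s = secPull r x ⊓ c s := fun s => by
      have h := congrArg (secPull r) (lamProjHom_inf_imageOpen x s)
      have h' : secPull r (lamProjHom F (x s)) ⊓ c s = secPull r x ⊓ c s :=
        (secPull_inf r _ _).symm.trans (h.trans (secPull_inf r _ _))
      rw [hbase, inf_assoc, inf_eq_right.mpr (show c s ≤ a from secPull_le r _)] at h'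
      exact (x.inf_eq_inf (hg s)).trans h'
    have h1 : x ⟨a, g⟩ ⊓ a = secPull r x ⊓ a := by
      have h2 : x ⟨a, g⟩ ⊓ ⨆ s, c s = secPull r x ⊓ ⨆ s, c s := by
        rw [inf_iSup_eq, inf_iSup_eq]
        exact iSup_congr key
      rwa [htop] at h2
    rwa [inf_eq_left.mpr (x.2.1 _), inf_eq_left.mpr (secPull_le r x)] at h1

end sheaf

variable (X)

/-! ### The equivalence and the (co)reflections -/

/-- `Λ` as a functor from sheaves to local homeomorphisms. -/
def lamSh : Sh X ⥤ LHOver X :=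
  MorphismProperty.Comma.lift (Sh.incl X ⋙ Lam X) (fun F => localHomeo_lamProj F.obj)
    (fun {F G} _ => localHomeo_of_postcomp _ (lamProj G.obj) (localHomeo_lamProj G.obj)
      (localHomeo_lamProj F.obj))
    (fun _ => trivial)

/-- `Γ` as a functor from locales over `X` to sheaves. -/
def gamSh : Over X ⥤ Sh X := ObjectProperty.lift _ (Gam X) isSheaf_Gam

/-- A map over `X` between local homeomorphisms is a local homeomorphism, so `LH/X` is a full
subcategory of `Loc/X`. -/
def fullyFaithfulIncl : (LHOver.incl X).FullyFaithful where
  preimage {f g} k := ⟨k, localHomeo_of_postcomp k.left g.hom g.prop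
    ((Over.w k).symm ▸ f.prop), trivial⟩

/-- The adjunction between `Sh(X)` and `Loc/X`. -/
noncomputable def lamGamShAdj : Sh.incl X ⋙ Lam X ⊣ gamSh X :=
  (lamGamAdj X).restrictFullyFaithful (fullyFaithfulSheafToPresheaf _ _)
    (Functor.FullyFaithful.id _) (Iso.refl _) (Iso.refl _)

/-- The adjunction between `Sh(X)` and `LH/X`. -/
noncomputable def shLHAdj : lamSh X ⊣ LHOver.incl X ⋙ gamSh X :=
  (lamGamAdj X).restrictFullyFaithful (fullyFaithfulSheafToPresheaf _ _)
    (fullyFaithfulIncl X) (Iso.refl _) (Iso.refl _)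

instance isIso_shLHAdj_unit_app (F : Sh X) : IsIso ((shLHAdj X).unit.app F) := by
  have h : IsIso (lamUnit F.obj) := by
    have : ∀ a, IsIso ((lamUnit F.obj).app a) := fun a =>
      (isIso_iff_bijective _).mpr (lamUnit_bijective F.property a.unop)
    exact NatIso.isIso_of_isIso_app _
  have e := (lamGamAdj X).map_restrictFullyFaithful_unit_app (fullyFaithfulSheafToPresheaf _ _)
    (fullyFaithfulIncl X) (L := lamSh X) (R := LHOver.incl X ⋙ gamSh X)
    (Iso.refl _) (Iso.refl _) F
  have h' : IsIso ((Sh.incl X).map ((shLHAdj X).unit.app F)) :=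
    e.symm ▸ IsIso.comp_isIso' h (IsIso.comp_isIso'
      (inferInstanceAs (IsIso ((Gam X).map (𝟙 ((Lam X).obj F.obj))))) (IsIso.id _))
  exact isIso_of_reflects_iso _ (Sh.incl X)

instance isIso_shLHAdj_counit_app (f : LHOver X) : IsIso ((shLHAdj X).counit.app f) := by
  have h : IsIso (lamCounit f.toComma) := isIso_lamCounit f.toComma f.prop
  have e := (lamGamAdj X).map_restrictFullyFaithful_counit_app (fullyFaithfulSheafToPresheaf _ _)
    (fullyFaithfulIncl X) (L := lamSh X) (R := LHOver.incl X ⋙ gamSh X)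
    (Iso.refl _) (Iso.refl _) f
  have h' : IsIso ((LHOver.incl X).map ((shLHAdj X).counit.app f)) :=
    e.symm ▸ IsIso.comp_isIso' (IsIso.id _) (IsIso.comp_isIso'
      (inferInstanceAs (IsIso ((Lam X).map (𝟙 ((Gam X).obj f.toComma))))) h)
  have := (fullyFaithfulIncl X).full
  have := (fullyFaithfulIncl X).reflectsIsomorphisms
  exact isIso_of_reflects_iso _ (LHOver.incl X)

/-- The equivalence between `Sh(X)` and `LH/X`. -/
noncomputable def shEquivLH : Sh X ≌ LHOver X := (shLHAdj X).toEquivalence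

/-- The coreflection of `Loc/X` in `LH/X` is `f ↦ ΛΓ(f)`. -/
theorem nonempty_coreflective_incl : Nonempty (Coreflective (LHOver.incl X)) :=
  ⟨{ (fullyFaithfulIncl X).full, (fullyFaithfulIncl X).faithful with
    R := gamSh X ⋙ lamSh X
    adj := ((shEquivLH X).symm.toAdjunction.comp (lamGamShAdj X)).ofNatIsoLeft
      (Functor.isoWhiskerRight (shEquivLH X).counitIso (LHOver.incl X) ≪≫
        Functor.leftUnitor _) }⟩

end SheafLocale

theorem corollary4p1 (X : Locale.{u}) :
    ∃ adj : Lam X ⊣ Gam X,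
      -- the unit sends `s` to the section `p_s` with `p_s^* x = x_s`
      (∀ (P : Psh X) (a : X) (s : P.obj (op a)) (x : LamFrame P),
        (pull (((adj.unit.app P).app (op a) s :
            Over.mk (openIncl X a) ⟶ Over.mk (lamProj P)).left) x : Set.Iic a).1 =
          LamFrame.coord x ⟨a, s⟩) ∧
      -- the counit at `f : Y ⟶ X` is given by `y ↦ (s^* y)_s`
      (∀ (f : Over X) (y : f.left) (a : X) (s : Over.mk (openIncl X a) ⟶ f),
        LamFrame.coord (P := (Gam X).obj f) (pull (adj.counit.app f).left y) ⟨a, s⟩ =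
          (pull s.left y : Set.Iic a).1) ∧
      -- the counit is an isomorphism at local homeomorphisms
      (∀ f : Over X, localHomeo f.hom → IsIso (adj.counit.app f)) ∧
      -- the unit is bijective at sheaves
      (∀ (F : Sh X) (a : X), Function.Bijective ((adj.unit.app F.obj).app (op a))) ∧
      -- `Λ` and `Γ` restrict to mutually inverse equivalences between `Sh(X)` and `LH/X`
      (∃ e : Sh X ≌ LHOver X,
        Nonempty (e.functor ⋙ LHOver.incl X ≅ Sh.incl X ⋙ Lam X) ∧
        Nonempty (e.inverse ⋙ Sh.incl X ≅ LHOver.incl X ⋙ Gam X)) ∧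
      -- `Sh(X)` is reflective in presheaves, and `LH/X` is coreflective in `Loc/X`
      Nonempty (Reflective (Sh.incl X)) ∧
      Nonempty (Coreflective (LHOver.incl X)) := by
  refine ⟨lamGamAdj X, fun _ _ _ _ => rfl, fun _ _ _ _ => rfl, isIso_lamCounit,
    fun F a => lamUnit_bijective F.property a,
    ⟨shEquivLH X, ⟨Iso.refl _⟩, ⟨Iso.refl _⟩⟩, ⟨inferInstance⟩, nonempty_coreflective_incl X⟩
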